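/- Let $\Omega\subset\mathbb{R}^2$ be a compact polygonal region (nonempty interior, boundary a finite union of line segments), with area $L$. Let $Y_1,\dots,Y_K\in\Omega$ ($K\ge1$) be distinct points, $S(X)=\min_k\|X-Y_k\|$ their distance transform, and $D_k=\{X\in\Omega:\|X-Y_k\|\le\|X-Y_j\|\text{ for all }j\}$ the Voronoi cell of $Y_k$ in $\Omega$. Assume that each $D_k$ is star-shaped with respect to $Y_k$ (this holds in particular if the cells are convex polygons). For an orientation $\theta$ put $e_\theta=(\cos\theta,\sin\theta)$, let $R_k(\theta)=\sup\{r\ge0: Y_k+re_\theta\in D_k\}$ be the length of the ray from $Y_k$ to the boundary of its cell, and let $$P(\theta)=\frac1L\sum_{k=1}^K\frac{R_k(\theta)^2}{2}.$$ For $0<\epsilon<\frac12$ let $$\Omega^\epsilon=\bigcup_{k=1}^K\{Y_k+re_\theta:\ 0\le\theta<2\pi,\ \epsilon R_k(\theta)\le r\le(1-\epsilon)R_k(\theta)\},$$ let $l^\epsilon$ be the square root of the area of $\Omega^\epsilon$, and for $\tau\ne0$ define $$F_\tau^\epsilon(u,v)=\frac{1}{2\pi\tau l^\epsilon}\iint_{\Omega^\epsilon}\exp\Big(\frac{iS(x,y)}{\tau}\Big)\exp\Big(\frac{-i(ux+vy)}{\tau}\Big)\,dx\,dy,$$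 $$P_\tau^\epsilon(\tilde r,\omega)=\big|F_\tau^\epsilon(\tilde r\cos\omega,\tilde r\sin\omega)\big|^2 .$$ Then for all $0<\epsilon<\frac12$, $\omega_0\in[0,2\pi)$ and $0<\Delta<2\pi$ the following hold. (i) $P$ is integrable over $[\omega_0,\omega_0+\Delta]$ and is the density of the orientation of the gradient of $S$ under the uniform distribution on $\Omega$: $$\frac1L\,\mathrm{area}\{X\in\Omega:\ \nabla S(X)\text{ exists and equals }e_t\text{ for some }t\in[\omega_0,\omega_0+\Delta]\}=\int_{\omega_0}^{\omega_0+\Delta}P(\omega)\,d\omega .$$ (ii) For every $\tau\ne0$ the function $P_\tau^\epsilon(\tilde r,\omega)\,\tilde r$ is integrable over $(0,\infty)\times[\omega_0,\omega_0+\Delta]$, and $$\lim_{\tau\to0}\int_{\omega_0}^{\omega_0+\Delta}\Big\{\int_0^\infty P_\tau^\epsilon(\tilde r,\omega)\,\tilde r\,d\tilde r\Big\}\,d\omega=\int_{\omega_0}^{\omega_0+\Delta}P(\omega)\,d\omega .$$ -/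

import Mathlib

open Real Set Filter Topology MeasureTheory

noncomputable section

namespace DistanceTransform

/-- The Euclidean plane. -/
abbrev Plane : Type := EuclideanSpace ℝ (Fin 2)

/-- The unit vector of orientation `θ`. -/
def dir (θ : ℝ) : Plane := !₂[Real.cos θ, Real.sin θ]

/-- A closed bounded region of the plane, with interior points, whose boundary consists of
finitely many straight line segments. -/
def IsPolygonalDomain (Ω : Set Plane) : Prop :=
  IsCompact Ω ∧ (interior Ω).Nonempty ∧
    ∃ s : Finset (Plane × Plane), frontier Ω = ⋃ p ∈ s, segment ℝ p.1 p.2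

/-- The Euclidean distance transform `S(X) = min_k ‖X - Y_k‖` of the point set `Y`
(a minimum, since the index set is finite; it is used only for `0 < K`). -/
def distTransform {K : ℕ} (Y : Fin K → Plane) (X : Plane) : ℝ :=
  ⨅ k, ‖X - Y k‖

/-- The Voronoi region of `Y k` inside `Ω`: the points of `Ω` for which `Y k` is a nearest point
of the point set. -/
def voronoiCell {K : ℕ} (Ω : Set Plane) (Y : Fin K → Plane) (k : Fin K) : Set Plane :=
  {X | X ∈ Ω ∧ ∀ j, ‖X - Y k‖ ≤ ‖X - Y j‖}

/-- `R_k(θ)`: the length of the ray from `Y k` to the boundary of its Voronoi region, in the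
orientation `θ`. -/
def rayLength {K : ℕ} (Ω : Set Plane) (Y : Fin K → Plane) (k : Fin K) (θ : ℝ) : ℝ :=
  sSup {r : ℝ | 0 ≤ r ∧ Y k + r • dir θ ∈ voronoiCell Ω Y k}

/-- The area of a set in the plane. -/
def area (A : Set Plane) : ℝ := (volume A).toReal

/-- The distribution of the orientation of `∇S` under the uniform distribution on `Ω`: the
fraction of the area of `Ω` where `∇S` exists and is the unit vector of an orientation in
`[θ, θ + Δ]`. -/
def orientationDistribution {K : ℕ} (Ω : Set Plane) (Y : Fin K → Plane) (θ Δ : ℝ) : ℝ :=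
  (1 / area Ω) * area {X | X ∈ Ω ∧ DifferentiableAt ℝ (distTransform Y) X ∧
    ∃ t ∈ Icc θ (θ + Δ), gradient (distTransform Y) X = dir t}

/-- The density `P(θ) = (1 / L) ∑_k R_k(θ)² / 2`. -/
def orientationDensity {K : ℕ} (Ω : Set Plane) (Y : Fin K → Plane) (θ : ℝ) : ℝ :=
  (1 / area Ω) * ∑ k, rayLength Ω Y k θ ^ 2 / 2

/-- `Y_k + D_k^ε`: the points `Y_k + r (cos θ, sin θ)` with `ε R_k(θ) ≤ r ≤ (1 - ε) R_k(θ)`. -/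
def trimmedCell {K : ℕ} (Ω : Set Plane) (Y : Fin K → Plane) (ε : ℝ) (k : Fin K) : Set Plane :=
  {X | ∃ θ ∈ Ico 0 (2 * π), ∃ r ∈ Icc (ε * rayLength Ω Y k θ) ((1 - ε) * rayLength Ω Y k θ),
    X = Y k + r • dir θ}

/-- `Ω^ε`, the union of the trimmed cells. -/
def trimmedDomain {K : ℕ} (Ω : Set Plane) (Y : Fin K → Plane) (ε : ℝ) : Set Plane :=
  ⋃ k, trimmedCell Ω Y ε k

/-- The normalized scaled Fourier transform of `exp(i S / τ)` over `Ω^ε`,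
`F_τ^ε(u, v) = (2 π τ l^ε)⁻¹ ∬_{Ω^ε} exp(i S(x, y) / τ) exp(-i (u x + v y) / τ) dx dy`,
where `l^ε` is the square root of the area of `Ω^ε`. -/
def waveTransform {K : ℕ} (Ω : Set Plane) (Y : Fin K → Plane) (ε τ u v : ℝ) : ℂ :=
  (1 / (2 * π * τ * √(area (trimmedDomain Ω Y ε))) : ℝ) *
    ∫ X in trimmedDomain Ω Y ε,
      Complex.exp (Complex.I * (distTransform Y X : ℂ) / (τ : ℂ)) *
        Complex.exp (-Complex.I * ((u * X 0 + v * X 1 : ℝ) : ℂ) / (τ : ℂ))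

/-- The power spectrum `P_τ^ε(r, ω) = |F_τ^ε(r cos ω, r sin ω)|²` in polar coordinates. -/
def powerSpectrum {K : ℕ} (Ω : Set Plane) (Y : Fin K → Plane) (ε τ r ω : ℝ) : ℝ :=
  ‖waveTransform Ω Y ε τ (r * Real.cos ω) (r * Real.sin ω)‖ ^ 2

end DistanceTransform

end

/-! Read as a density on the frequency plane, the power spectrum defines a measure
(`spectralMeasure`). By Plancherel it has mass one, and its characteristic function at ξ is the
autocorrelation of the wave exp(iS/τ) on Ω^ε at the lag τξ, divided by the area of Ω^ε
(`charFun_spectralMeasure`). Up to a boundary term this correlation integrates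
exp(i(S(X+τξ)-S(X))/τ), which tends almost everywhere to exp(i⟨∇S(X),ξ⟩) as τ → 0. Dominated
convergence therefore gives the characteristic function of `gradientLaw`, the law of ∇S for uniform
X in Ω^ε, and Lévy's theorem gives weak convergence. No stationary phase expansion is needed.

Weak convergence passes to the sector of orientations in [ω₀, ω₀+Δ], because its frontier is null
for the limit law: ∇S is nonzero almost everywhere, and a single orientation carries no area. In
polar coordinates the spectral mass of the sector is the double integral of the theorem.

The limit law is then computed cell by cell. On the ray of orientation θ from Y_k the gradient is
e_θ, so the part of a cell with orientations in the window has area ∫ R_k²/2. Trimming multiplies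
this by (1-ε)²-ε² = 1-2ε for every orientation, and the total area by the same factor. The factor
cancels and the density is P, whatever ε is. -/

namespace DistanceTransform

/-! ### Plancherel's formula for integrable and square-integrable functions -/

section Plancherel

open FourierTransform ComplexInnerProductSpace SchwartzMap

variable {E : Type*} [NormedAddCommGroup E] [InnerProductSpace ℝ E] [FiniteDimensional ℝ E]
  [MeasurableSpace E] [BorelSpace E]

/-- On `L¹ ∩ L²` the `L²`-Fourier transform is given by the Fourier integral. -/
theorem fourier_toLp_ae_eq {f : E → ℂ} (hf : Integrable f) (hf2 : MemLp f 2) :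
    (𝓕 (hf2.toLp f) : Lp ℂ 2 (volume : Measure E)) =ᵐ[volume] 𝓕 f := by
  have hc : Continuous (𝓕 f) :=
    VectorFourier.fourierIntegral_continuous Real.continuous_fourierChar
      (by exact continuous_inner) hf
  -- Both sides are tested against smooth compactly supported functions. For each transform the
  -- Fourier operator can be moved onto the test function, one as a tempered distribution and the
  -- other by Fubini.
  refine ae_eq_of_integral_contDiff_smul_eq ((Lp.memLp _).locallyIntegrable (by norm_num))
    hc.locallyIntegrable ?_
  intro g hg hgc
  have hgC : ContDiff ℝ ((⊤ : ℕ∞) : WithTop ℕ∞) (fun x => (g x : ℂ)) := Complex.ofRealCLM.contDiff.comp hg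
  have hgCc : HasCompactSupport (fun x => (g x : ℂ)) := hgc.comp_left (g := Complex.ofReal) rfl
  let φ : 𝓢(E, ℂ) := hgCc.toSchwartzMap hgC
  have hφ : ∀ x, φ x = (g x : ℂ) := fun x => rfl
  have key := congrArg (fun T : 𝓢'(E, ℂ) => T φ)
    (Lp.fourier_toTemperedDistribution_eq (hf2.toLp f))
  simp only [TemperedDistribution.fourier_apply, Lp.toTemperedDistribution_apply] at key
  calc ∫ x, g x • (𝓕 (hf2.toLp f) : Lp ℂ 2 (volume : Measure E)) x
      = ∫ x, φ x • (𝓕 (hf2.toLp f) : Lp ℂ 2 (volume : Measure E)) x := by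
        simp [hφ]
    _ = ∫ x, (𝓕 φ) x • (hf2.toLp f) x := key.symm
    _ = ∫ x, (𝓕 φ) x • f x := by
        refine integral_congr_ae ?_
        filter_upwards [hf2.coeFn_toLp] with x hx
        rw [hx]
    _ = ∫ x, φ x • 𝓕 f x := by
        have := VectorFourier.integral_fourierIntegral_smul_eq_flip (μ := (volume : Measure E))
          (ν := (volume : Measure E)) (L := innerₗ E)
          (f := φ) (g := f) Real.continuous_fourierChar (by exact continuous_inner)
          φ.integrable hf
        rw [flip_innerₗ] at this
        rw [SchwartzMap.fourier_coe]
        exact this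
    _ = ∫ x, g x • 𝓕 f x := by simp [hφ]

/-- The Fourier integral of a translate. -/
theorem fourier_comp_add_right (f : E → ℂ) (h w : E) :
    𝓕 (fun x => f (x + h)) w = Real.fourierChar (inner ℝ h w) * 𝓕 f w := by
  have := congrFun (VectorFourier.fourierIntegral_comp_add_right Real.fourierChar
    (volume : Measure E) (innerₗ E) f h) w
  exact this

theorem integrable_norm_sq_fourier {f : E → ℂ} (hf : Integrable f) (hf2 : MemLp f 2) :
    Integrable (fun w => ‖𝓕 f w‖ ^ 2) := by
  have h : MemLp (𝓕 f) 2 := (Lp.memLp (𝓕 (hf2.toLp f))).ae_eq (fourier_toLp_ae_eq hf hf2)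
  exact h.integrable_norm_pow (by norm_num)

/-- Plancherel's formula for a function and its translate. -/
theorem integral_fourierChar_mul_norm_sq_fourier {f : E → ℂ} (hf : Integrable f)
    (hf2 : MemLp f 2) (h : E) :
    ∫ w, (Real.fourierChar (inner ℝ h w) : ℂ) * ((‖𝓕 f w‖ ^ 2 : ℝ) : ℂ) =
      ∫ x, f (x + h) * (starRingEnd ℂ) (f x) := by
  have hg : Integrable (fun x => f (x + h)) := hf.comp_add_right h
  have hg2 : MemLp (fun x => f (x + h)) 2 :=
    hf2.comp_measurePreserving (measurePreserving_add_right volume h)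
  have key := Lp.inner_fourier_eq (hf2.toLp f) (hg2.toLp _)
  rw [L2.inner_def, L2.inner_def] at key
  calc ∫ w, (Real.fourierChar (inner ℝ h w) : ℂ) * ((‖𝓕 f w‖ ^ 2 : ℝ) : ℂ)
      = ∫ w, ⟪(𝓕 (hf2.toLp f) : Lp ℂ 2 (volume : Measure E)) w,
          (𝓕 (hg2.toLp _) : Lp ℂ 2 (volume : Measure E)) w⟫ := by
        refine integral_congr_ae ?_
        filter_upwards [fourier_toLp_ae_eq hf hf2, fourier_toLp_ae_eq hg hg2] with w h1 h2
        rw [h1, h2, fourier_comp_add_right, RCLike.inner_apply, mul_assoc, Complex.mul_conj']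
        push_cast
        rfl
    _ = _ := key
    _ = _ := by
        refine integral_congr_ae ?_
        filter_upwards [hf2.coeFn_toLp, hg2.coeFn_toLp] with w h1 h2
        rw [h1, h2, RCLike.inner_apply]

end Plancherel

/-- The **Lévy convergence theorem** along a countably generated filter. -/
theorem tendsto_probabilityMeasure_of_tendsto_charFun {ι E : Type*} [NormedAddCommGroup E]
    [InnerProductSpace ℝ E] [FiniteDimensional ℝ E] [MeasurableSpace E] [BorelSpace E]
    {l : Filter ι} [l.IsCountablyGenerated] {μ : ι → ProbabilityMeasure E}
    {μ₀ : ProbabilityMeasure E}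
    (h : ∀ t : E, Tendsto (fun i => charFun (μ i) t) l (𝓝 (charFun μ₀ t))) :
    Tendsto μ l (𝓝 μ₀) := by
  -- Countable generation of the filter reduces the claim to sequences.
  refine tendsto_of_seq_tendsto fun u hu => ?_
  exact ProbabilityMeasure.tendsto_of_tendsto_charFun fun t => (h t).comp hu

open scoped ENNReal

/-! ### Orientations, polar coordinates and sectors -/

theorem dir_apply_zero (θ : ℝ) : dir θ 0 = Real.cos θ := rfl

theorem dir_apply_one (θ : ℝ) : dir θ 1 = Real.sin θ := rfl

theorem norm_dir (θ : ℝ) : ‖dir θ‖ = 1 := by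
  simp [EuclideanSpace.norm_eq, Fin.sum_univ_two, dir_apply_zero, dir_apply_one]

theorem norm_smul_dir {r : ℝ} (hr : 0 ≤ r) (θ : ℝ) : ‖r • dir θ‖ = r := by
  rw [norm_smul, norm_dir, mul_one, Real.norm_of_nonneg hr]

theorem continuous_dir : Continuous dir := by
  unfold dir
  refine (PiLp.continuous_toLp 2 _).comp (continuous_pi fun i => ?_)
  fin_cases i
  · exact Real.continuous_cos
  · exact Real.continuous_sin

theorem periodic_dir : Function.Periodic dir (2 * π) := fun t => by
  simp [dir]

theorem dir_injOn (a : ℝ) : InjOn dir (Ioc a (a + 2 * π)) := by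
  intro s hs t ht h
  have hc : Real.cos s = Real.cos t := congrArg (fun X : Plane => X 0) h
  have hs' : Real.sin s = Real.sin t := congrArg (fun X : Plane => X 1) h
  obtain ⟨n, hn⟩ := Real.Angle.angle_eq_iff_two_pi_dvd_sub.1 (Real.Angle.cos_sin_inj hc hs')
  have hπ := Real.pi_pos
  have h1 : (n : ℝ) < 1 := by
    by_contra! hcon
    nlinarith [hs.1, hs.2, ht.1, ht.2]
  have h2 : (-1 : ℝ) < n := by
    by_contra! hcon
    nlinarith [hs.1, hs.2, ht.1, ht.2]
  have h3 : n = 0 := by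
    have h1' : n < 1 := by exact_mod_cast h1
    have h2' : -1 < n := by exact_mod_cast h2
    omega
  rw [h3] at hn
  simp at hn
  linarith

/-- The principal value of the orientation of a plane vector. -/
noncomputable def argument (X : Plane) : ℝ := Complex.arg ⟨X 0, X 1⟩

theorem measurable_argument : Measurable argument := by
  unfold argument
  refine Complex.measurable_arg.comp ?_
  refine Complex.measurableEquivRealProd.symm.measurable.comp (f := fun X : Plane => (X 0, X 1)) ?_
  fun_prop

theorem norm_smul_dir_argument (X : Plane) : ‖X‖ • dir (argument X) = X := by
  have hn : ‖X‖ = ‖(⟨X 0, X 1⟩ : ℂ)‖ := by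
    rw [EuclideanSpace.norm_eq, Complex.norm_def, Complex.normSq_mk]
    simp [Fin.sum_univ_two, sq]
  ext i
  fin_cases i
  · simp [argument, dir, hn]
  · simp [argument, dir, hn]

theorem exists_norm_smul_dir (X : Plane) (a : ℝ) :
    ∃ t ∈ Ioc a (a + 2 * π), X = ‖X‖ • dir t := by
  refine ⟨toIocMod Real.two_pi_pos a (argument X), toIocMod_mem_Ioc _ _ _, ?_⟩
  rw [toIocMod, periodic_dir.sub_zsmul_eq, norm_smul_dir_argument]

theorem smul_dir_eq_smul_dir {r s x y : ℝ} (hr : 0 < r) (hs : 0 ≤ s)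
    (h : r • dir x = s • dir y) : r = s ∧ dir x = dir y := by
  have hrs : r = s := by
    rw [← norm_smul_dir hr.le x, h, norm_smul_dir hs]
  subst hrs
  exact ⟨rfl, smul_right_injective _ hr.ne' h⟩

/-- Integration over the plane in polar coordinates, with an arbitrary window of orientations. -/
theorem lintegral_polar (a : ℝ) {f : Plane → ℝ≥0∞} (hf : Measurable f) :
    ∫⁻ X, f X = ∫⁻ ω in Ioc a (a + 2 * π), ∫⁻ r in Ioi (0 : ℝ),
      ENNReal.ofReal r * f (r • dir ω) := by
  have hψ : MeasurePreserving (fun p : ℝ × ℝ => (!₂[p.1, p.2] : Plane)) :=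
    (PiLp.volume_preserving_toLp (Fin 2)).comp (volume_preserving_finTwoArrow ℝ).symm
  have hm : Measurable fun p : ℝ × ℝ => ENNReal.ofReal p.1 * f (p.1 • dir p.2) := by
    have := continuous_dir.measurable
    fun_prop
  have hper : Function.Periodic (fun ω => ∫⁻ r in Ioi (0 : ℝ), ENNReal.ofReal r * f (r • dir ω))
      (2 * π) := fun ω => by simp only [periodic_dir ω]
  calc ∫⁻ X, f X = ∫⁻ p : ℝ × ℝ, f !₂[p.1, p.2] := (hψ.lintegral_comp hf).symm
    _ = ∫⁻ p in polarCoord.target, ENNReal.ofReal p.1 * f (p.1 • dir p.2) := by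
        rw [← lintegral_comp_polarCoord_symm]
        refine lintegral_congr fun p => ?_
        have : (p.1 • dir p.2 : Plane) = !₂[(polarCoord.symm p).1, (polarCoord.symm p).2] := by
          ext i
          fin_cases i <;> simp [dir]
        rw [this, smul_eq_mul]
    _ = ∫⁻ ω in Ioo (-π) π, ∫⁻ r in Ioi (0 : ℝ), ENNReal.ofReal r * f (r • dir ω) := by
        rw [polarCoord_target, Measure.volume_eq_prod, setLIntegral_prod_symm _ hm.aemeasurable]
    _ = ∫⁻ ω in Ioc (-π) (-π + 2 * π), ∫⁻ r in Ioi (0 : ℝ), ENNReal.ofReal r * f (r • dir ω) := by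
        rw [setLIntegral_congr Ioo_ae_eq_Ioc, show -π + 2 * π = π by ring]
    _ = _ := by
        -- The integrand is 2π-periodic, and any two half-open windows of length 2π are fundamental
        -- domains for the translations by multiples of 2π.
        have : VAddInvariantMeasure (AddSubgroup.zmultiples (2 * π)) ℝ volume :=
          ⟨fun c s _ => measure_preimage_add _ _ _⟩
        exact IsAddFundamentalDomain.setLIntegral_eq (G := AddSubgroup.zmultiples (2 * π))
          (isAddFundamentalDomain_Ioc Real.two_pi_pos (-π))
          (isAddFundamentalDomain_Ioc Real.two_pi_pos a)
          (fun ω => ∫⁻ r in Ioi (0 : ℝ), ENNReal.ofReal r * f (r • dir ω)) hper.map_vadd_zmultiples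

/-- The closed cone of the orientations in `[a, b]`. -/
def closedCone (a b : ℝ) : Set Plane := {X | ∃ t ∈ Icc a b, X = ‖X‖ • dir t}

/-- The sector of the orientations in `[a, b]`, without its apex. -/
def sector (a b : ℝ) : Set Plane := closedCone a b \ {0}

/-- The orientation ranges over a compact interval, so the projection that forgets it is a closed
map. -/
theorem isClosed_closedCone (a b : ℝ) : IsClosed (closedCone a b) := by
  have h : closedCone a b =
      Prod.fst '' {p : Plane × Icc a b | p.1 = ‖p.1‖ • dir p.2} := by
    ext X
    constructor
    · rintro ⟨t, ht, h⟩
      exact ⟨(X, ⟨t, ht⟩), h, rfl⟩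
    · rintro ⟨⟨X, t⟩, h, rfl⟩
      exact ⟨t, t.2, h⟩
  rw [h]
  refine isClosedMap_fst_of_compactSpace _ (isClosed_eq continuous_fst ?_)
  exact continuous_fst.norm.smul (continuous_dir.comp (continuous_subtype_val.comp continuous_snd))

theorem measurableSet_sector (a b : ℝ) : MeasurableSet (sector a b) :=
  (isClosed_closedCone a b).measurableSet.diff (measurableSet_singleton 0)

theorem smul_dir_mem_sector {r : ℝ} (hr : 0 < r) {a b ω : ℝ} :
    r • dir ω ∈ sector a b ↔ dir ω ∈ dir '' Icc a b := by
  have h0 : r • dir ω ≠ 0 := by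
    rw [← norm_ne_zero_iff, norm_smul_dir hr.le]
    exact hr.ne'
  constructor
  · rintro ⟨⟨t, ht, h⟩, -⟩
    rw [norm_smul_dir hr.le] at h
    exact ⟨t, ht, (smul_dir_eq_smul_dir hr hr.le h).2.symm⟩
  · rintro ⟨t, ht, h⟩
    exact ⟨⟨t, ht, by rw [norm_smul_dir hr.le, h]⟩, h0⟩

theorem smul_mem_sector {r : ℝ} (hr : 0 < r) {a b : ℝ} {X : Plane} :
    r • X ∈ sector a b ↔ X ∈ sector a b := by
  rcases eq_or_ne X 0 with rfl | hX
  · simp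
  have hX' : 0 < ‖X‖ := norm_pos_iff.2 hX
  rw [← norm_smul_dir_argument X, smul_smul, smul_dir_mem_sector (mul_pos hr hX'),
    smul_dir_mem_sector hX']

/-- Integration over a sector in polar coordinates. -/
theorem setLIntegral_sector {a b : ℝ} (hab : a ≤ b) (hb : b < a + 2 * π) {f : Plane → ℝ≥0∞}
    (hf : Measurable f) :
    ∫⁻ X in sector a b, f X = ∫⁻ ω in Icc a b, ∫⁻ r in Ioi (0 : ℝ),
      ENNReal.ofReal r * f (r • dir ω) := by
  have hs : Ioc a b ⊆ Ioc a (a + 2 * π) := Ioc_subset_Ioc_right hb.le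
  rw [← lintegral_indicator (measurableSet_sector a b),
    lintegral_polar a (hf.indicator (measurableSet_sector a b)),
    setLIntegral_congr (Ioc_ae_eq_Icc (a := a) (b := b)).symm, ← inter_eq_self_of_subset_left hs,
    ← Measure.restrict_restrict measurableSet_Ioc,
    ← lintegral_indicator (measurableSet_Ioc (a := a) (b := b))]
  refine setLIntegral_congr_fun_ae measurableSet_Ioc ?_
  -- The end a + 2π has the direction of a, hence lies on the sector, but it is outside `Ioc a b`.
  -- It is discarded as a null set.
  filter_upwards [(measure_singleton (a + 2 * π) : volume {a + 2 * π} = 0)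
    |> measure_eq_zero_iff_ae_notMem.1] with ω hω hω'
  by_cases hωb : ω ≤ b
  · rw [indicator_of_mem (show ω ∈ Ioc a b from ⟨hω'.1, hωb⟩)]
    refine setLIntegral_congr_fun measurableSet_Ioi fun r hr => ?_
    beta_reduce
    rw [indicator_of_mem ((smul_dir_mem_sector hr).2 ⟨ω, ⟨hω'.1.le, hωb⟩, rfl⟩)]
  · rw [indicator_of_notMem (fun h : ω ∈ Ioc a b => hωb h.2)]
    refine (setLIntegral_congr_fun measurableSet_Ioi fun r hr => ?_).trans lintegral_zero
    beta_reduce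
    rw [indicator_of_notMem, mul_zero]
    rw [smul_dir_mem_sector hr]
    rintro ⟨t, ht, h⟩
    rcases eq_or_lt_of_le ht.1 with rfl | hta
    · have := dir_injOn a ⟨by linarith [Real.two_pi_pos], le_rfl⟩ hω'
        ((periodic_dir a).trans h)
      exact hω this.symm
    · have := dir_injOn a ⟨hta, by linarith [ht.2]⟩ hω' h
      exact hωb (this ▸ ht.2)

/-- The closed cones over [a, b] and [b, a + 2π] cover the plane, so a nonzero frontier point lies
in both. Injectivity of `dir` on a window then leaves only the two end orientations. -/
theorem frontier_sector_subset {a b : ℝ} (hab : a ≤ b) (hb : b < a + 2 * π) :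
    frontier (sector a b) ⊆ {0} ∪ sector a a ∪ sector b b := by
  intro X hX
  rcases eq_or_ne X 0 with rfl | hX0
  · exact Or.inl (Or.inl rfl)
  have h1 : X ∈ closedCone a b :=
    closure_minimal sdiff_subset (isClosed_closedCone a b) hX.1
  have h2 : X ∈ closedCone b (a + 2 * π) := by
    by_contra hcon
    refine hX.2 (mem_interior.2 ⟨(closedCone b (a + 2 * π))ᶜ ∩ {0}ᶜ, ?_,
      (isClosed_closedCone _ _).isOpen_compl.inter isOpen_compl_singleton, hcon, hX0⟩)
    rintro Z ⟨hZ, hZ0⟩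
    obtain ⟨t, ht, hZt⟩ := exists_norm_smul_dir Z a
    refine ⟨⟨t, ⟨ht.1.le, ?_⟩, hZt⟩, hZ0⟩
    by_contra! hbt
    exact hZ ⟨t, ⟨hbt.le, ht.2⟩, hZt⟩
  obtain ⟨s, hs, hXs⟩ := h1
  obtain ⟨t, ht, hXt⟩ := h2
  have hst := smul_right_injective Plane (norm_ne_zero_iff.2 hX0) (hXs.symm.trans hXt)
  rcases eq_or_lt_of_le hs.1 with rfl | hsa
  · exact Or.inl (Or.inr ⟨⟨a, ⟨le_rfl, le_rfl⟩, hXs⟩, hX0⟩)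
  · rcases eq_or_lt_of_le hab with rfl | hab'
    · exact absurd hs.2 (not_le.2 hsa)
    have := dir_injOn a ⟨hsa, by linarith [hs.2]⟩ ⟨hab'.trans_le ht.1, ht.2⟩ hst
    have hsb : s = b := le_antisymm hs.2 (this ▸ ht.1)
    exact Or.inr ⟨⟨b, ⟨le_rfl, le_rfl⟩, hsb ▸ hXs⟩, hX0⟩

theorem lintegral_ofReal_indicator_Icc {p q : ℝ} (hp : 0 ≤ p) (hpq : p ≤ q) :
    ∫⁻ r in Ioi (0 : ℝ), ENNReal.ofReal r * (Icc p q).indicator 1 r =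
      ENNReal.ofReal ((q ^ 2 - p ^ 2) / 2) := by
  calc ∫⁻ r in Ioi (0 : ℝ), ENNReal.ofReal r * (Icc p q).indicator 1 r
      = ∫⁻ r in Ioi (0 : ℝ), (Ioc p q).indicator (fun r => ENNReal.ofReal r) r := by
        refine lintegral_congr_ae (ae_restrict_of_ae ?_)
        filter_upwards [(measure_singleton p : volume {p} = 0) |> measure_eq_zero_iff_ae_notMem.1]
          with r hr
        by_cases h : r ∈ Icc p q
        · have h' : r ∈ Ioc p q := ⟨lt_of_le_of_ne h.1 fun e => hr e.symm, h.2⟩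
          simp [h, h']
        · have h' : r ∉ Ioc p q := fun h' => h ⟨h'.1.le, h'.2⟩
          simp [h, h']
    _ = ∫⁻ r in Ioc p q, ENNReal.ofReal r := by
        rw [lintegral_indicator measurableSet_Ioc, Measure.restrict_restrict measurableSet_Ioc,
          inter_eq_self_of_subset_left fun r hr => mem_Ioi.2 (hp.trans_lt hr.1)]
    _ = ENNReal.ofReal (∫ r in Ioc p q, r) := by
        rw [ofReal_integral_eq_lintegral_ofReal]
        · exact (intervalIntegral.intervalIntegrable_id).1
        · refine (ae_restrict_iff' measurableSet_Ioc).2 (Eventually.of_forall fun r hr => ?_)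
          exact hp.trans hr.1.le
    _ = _ := by rw [← intervalIntegral.integral_of_le hpq, integral_id]

/-! ### Areas of sets that meet each ray from a point in an interval -/

section Annular

variable {B : Set Plane} {y : Plane} {ρ : ℝ → ℝ} {α β : ℝ}

theorem lintegral_annular_ray (hα : 0 ≤ α) (hαβ : α ≤ β) (hρ : ∀ ω, 0 ≤ ρ ω)
    (h : ∀ r > 0, ∀ ω, y + r • dir ω ∈ B ↔ r ∈ Icc (α * ρ ω) (β * ρ ω)) (ω : ℝ) :
    ∫⁻ r in Ioi (0 : ℝ), ENNReal.ofReal r * ((y + ·) ⁻¹' B).indicator 1 (r • dir ω) =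
      ENNReal.ofReal ((β ^ 2 - α ^ 2) * (ρ ω ^ 2 / 2)) := by
  rw [show (β ^ 2 - α ^ 2) * (ρ ω ^ 2 / 2) = ((β * ρ ω) ^ 2 - (α * ρ ω) ^ 2) / 2 by ring,
    ← lintegral_ofReal_indicator_Icc (mul_nonneg hα (hρ ω))
      (mul_le_mul_of_nonneg_right hαβ (hρ ω))]
  refine setLIntegral_congr_fun measurableSet_Ioi fun r hr => ?_
  beta_reduce
  congr 1
  by_cases hr' : r ∈ Icc (α * ρ ω) (β * ρ ω)
  · rw [indicator_of_mem hr', indicator_of_mem (show r • dir ω ∈ (y + ·) ⁻¹' B from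
      (h r hr ω).2 hr')]
    rfl
  · rw [indicator_of_notMem hr', indicator_of_notMem]
    exact fun hcon => hr' ((h r hr ω).1 hcon)

/-- The area of a set which is an interval on each ray from `y`. -/
theorem volume_annular (hB : MeasurableSet B) (hα : 0 ≤ α) (hαβ : α ≤ β) (hρ : ∀ ω, 0 ≤ ρ ω)
    (h : ∀ r > 0, ∀ ω, y + r • dir ω ∈ B ↔ r ∈ Icc (α * ρ ω) (β * ρ ω)) (a : ℝ) :
    volume B = ∫⁻ ω in Ioc a (a + 2 * π), ENNReal.ofReal ((β ^ 2 - α ^ 2) * (ρ ω ^ 2 / 2)) := by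
  have hB' : MeasurableSet ((y + ·) ⁻¹' B) := measurable_const_add y hB
  rw [← measure_preimage_add volume y B, ← lintegral_indicator_one hB',
    lintegral_polar a (measurable_one.indicator hB')]
  exact lintegral_congr fun ω => lintegral_annular_ray hα hαβ hρ h ω

theorem volume_annular_sector (hB : MeasurableSet B) (hα : 0 ≤ α) (hαβ : α ≤ β)
    (hρ : ∀ ω, 0 ≤ ρ ω)
    (h : ∀ r > 0, ∀ ω, y + r • dir ω ∈ B ↔ r ∈ Icc (α * ρ ω) (β * ρ ω))
    {a b : ℝ} (hab : a ≤ b) (hb : b < a + 2 * π) :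
    volume (B ∩ {X | X - y ∈ sector a b}) =
      ∫⁻ ω in Icc a b, ENNReal.ofReal ((β ^ 2 - α ^ 2) * (ρ ω ^ 2 / 2)) := by
  have hB' : MeasurableSet ((y + ·) ⁻¹' B) := measurable_const_add y hB
  have hpre : (y + ·) ⁻¹' (B ∩ {X | X - y ∈ sector a b}) = (y + ·) ⁻¹' B ∩ sector a b := by
    ext X
    simp
  rw [← measure_preimage_add volume y, hpre, ← Measure.restrict_apply hB',
    ← lintegral_indicator_one hB', setLIntegral_sector hab hb (measurable_one.indicator hB')]
  exact lintegral_congr fun ω => lintegral_annular_ray hα hαβ hρ h ω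

end Annular

/-! ### Voronoi cells and the gradient of the distance transform -/

section Cells

variable {K : ℕ} {Ω : Set Plane} {Y : Fin K → Plane} {k : Fin K}

theorem isCompact_voronoiCell (hΩ : IsCompact Ω) (k : Fin K) :
    IsCompact (voronoiCell Ω Y k) := by
  have : voronoiCell Ω Y k = Ω ∩ ⋂ j, {X | ‖X - Y k‖ ≤ ‖X - Y j‖} := by
    ext X
    simp [voronoiCell]
  rw [this]
  refine hΩ.inter_right (isClosed_iInter fun j => isClosed_le ?_ ?_) <;> fun_prop

theorem self_mem_voronoiCell (hk : Y k ∈ Ω) : Y k ∈ voronoiCell Ω Y k :=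
  ⟨hk, fun j => by simp⟩

theorem rayLength_nonneg (θ : ℝ) : 0 ≤ rayLength Ω Y k θ :=
  Real.sSup_nonneg fun _ hr => hr.1

theorem rayLength_congr {s t : ℝ} (h : dir s = dir t) :
    rayLength Ω Y k s = rayLength Ω Y k t := by
  simp only [rayLength, h]

theorem isCompact_rayLength_set (hΩ : IsCompact Ω) (θ : ℝ) :
    IsCompact {r : ℝ | 0 ≤ r ∧ Y k + r • dir θ ∈ voronoiCell Ω Y k} := by
  have hD := isCompact_voronoiCell (Y := Y) hΩ k
  obtain ⟨C, hC⟩ := hD.isBounded.exists_norm_le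
  refine (isCompact_Icc (a := (0 : ℝ)) (b := C + ‖Y k‖)).of_isClosed_subset ?_ fun r hr => ?_
  · exact isClosed_Ici.inter (hD.isClosed.preimage (by fun_prop))
  · refine ⟨hr.1, ?_⟩
    have := norm_sub_le (Y k + r • dir θ) (Y k)
    rw [add_sub_cancel_left, norm_smul_dir hr.1] at this
    linarith [hC _ hr.2]

/-- A star-shaped cell consists of the rays from its centre of the lengths `rayLength`. -/
theorem mem_voronoiCell_iff (hΩ : IsCompact Ω) (hk : Y k ∈ Ω)
    (hstar : StarConvex ℝ (Y k) (voronoiCell Ω Y k)) {r : ℝ} (hr : 0 ≤ r) (θ : ℝ) :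
    Y k + r • dir θ ∈ voronoiCell Ω Y k ↔ r ≤ rayLength Ω Y k θ := by
  have hT := isCompact_rayLength_set (Y := Y) (k := k) hΩ θ
  constructor
  · exact fun h => le_csSup hT.bddAbove ⟨hr, h⟩
  · intro h
    -- The supremum is attained: the set of admissible lengths is compact and contains 0.
    have hmem := (hT.sSup_mem ⟨0, le_rfl, by simpa using self_mem_voronoiCell hk⟩).2
    rcases eq_or_lt_of_le hr with rfl | hr0
    · simpa using self_mem_voronoiCell hk
    have hR : 0 < rayLength Ω Y k θ := hr0.trans_le h
    have := hstar.add_smul_mem hmem (div_nonneg hr hR.le) ((div_le_one hR).2 h)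
    rw [smul_smul] at this
    change Y k + (r / rayLength Ω Y k θ * rayLength Ω Y k θ) • dir θ ∈ _ at this
    rwa [div_mul_cancel₀ _ hR.ne'] at this

/-- By star-shapedness, the ray has length at least a ≥ 0 exactly when its point at distance a is in
the cell. The superlevel sets are therefore closed. -/
theorem measurable_rayLength (hΩ : IsCompact Ω) (hk : Y k ∈ Ω)
    (hstar : StarConvex ℝ (Y k) (voronoiCell Ω Y k)) : Measurable (rayLength Ω Y k) := by
  refine measurable_of_Ici fun a => ?_
  rcases le_or_gt 0 a with ha | ha
  · have : rayLength Ω Y k ⁻¹' Ici a = {θ | Y k + a • dir θ ∈ voronoiCell Ω Y k} := by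
      ext θ
      exact (mem_voronoiCell_iff hΩ hk hstar ha θ).symm
    rw [this]
    have hc := continuous_dir
    exact ((isCompact_voronoiCell hΩ k).isClosed.preimage (by fun_prop)).measurableSet
  · convert MeasurableSet.univ
    exact eq_univ_of_forall fun θ => ha.le.trans (rayLength_nonneg θ)

theorem mem_trimmedCell_iff {ε r : ℝ} (hε : 0 ≤ ε) (hr : 0 < r) (ω : ℝ) :
    Y k + r • dir ω ∈ trimmedCell Ω Y ε k ↔
      r ∈ Icc (ε * rayLength Ω Y k ω) ((1 - ε) * rayLength Ω Y k ω) := by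
  constructor
  · rintro ⟨θ, -, s, hs, h⟩
    have hs0 : 0 ≤ s := (mul_nonneg hε (rayLength_nonneg θ)).trans hs.1
    obtain ⟨rfl, hd⟩ := smul_dir_eq_smul_dir hr hs0 (add_left_cancel h)
    rwa [rayLength_congr hd]
  · intro h
    have hd : dir (toIcoMod Real.two_pi_pos 0 ω) = dir ω := by
      rw [toIcoMod, periodic_dir.sub_zsmul_eq]
    refine ⟨toIcoMod Real.two_pi_pos 0 ω, ?_, r, ?_, by rw [hd]⟩
    · simpa using toIcoMod_mem_Ico Real.two_pi_pos 0 ω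
    · rwa [rayLength_congr hd]

theorem trimmedCell_subset (hΩ : IsCompact Ω) (hk : Y k ∈ Ω)
    (hstar : StarConvex ℝ (Y k) (voronoiCell Ω Y k)) {ε : ℝ} (hε : 0 ≤ ε) :
    trimmedCell Ω Y ε k ⊆ voronoiCell Ω Y k := by
  rintro _ ⟨θ, -, r, hr, rfl⟩
  have hR := rayLength_nonneg (Ω := Ω) (Y := Y) (k := k) θ
  refine (mem_voronoiCell_iff hΩ hk hstar ((mul_nonneg hε hR).trans hr.1) θ).2 ?_
  nlinarith [hr.2]

theorem measurableSet_trimmedCell (hΩ : IsCompact Ω) (hk : Y k ∈ Ω)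
    (hstar : StarConvex ℝ (Y k) (voronoiCell Ω Y k)) {ε : ℝ} (hε : 0 ≤ ε) :
    MeasurableSet (trimmedCell Ω Y ε k) := by
  -- The centre has no orientation of its own and `argument` gives it a default value, so it is
  -- split off. Elsewhere membership is an inequality between measurable functions.
  have h : trimmedCell Ω Y ε k = (trimmedCell Ω Y ε k ∩ {Y k}) ∪
      ({Y k}ᶜ ∩ {X | ‖X - Y k‖ ∈ Icc (ε * rayLength Ω Y k (argument (X - Y k)))
        ((1 - ε) * rayLength Ω Y k (argument (X - Y k)))}) := by
    ext X
    by_cases hX : X = Y k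
    · simp [hX]
    · have hpos : 0 < ‖X - Y k‖ := norm_pos_iff.2 (sub_ne_zero.2 hX)
      have := mem_trimmedCell_iff (Ω := Ω) (Y := Y) (k := k) hε hpos (argument (X - Y k))
      rw [norm_smul_dir_argument, add_sub_cancel] at this
      simp [hX, this]
  rw [h]
  have hm : Measurable fun X => rayLength Ω Y k (argument (X - Y k)) :=
    (measurable_rayLength hΩ hk hstar).comp (measurable_argument.comp (measurable_id.sub_const _))
  refine (subsingleton_singleton.anti inter_subset_right).measurableSet.union
    ((measurableSet_singleton _).compl.inter ?_)
  exact (measurableSet_le (hm.const_mul _) (by fun_prop)).inter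
    (measurableSet_le (by fun_prop) (hm.const_mul _))

theorem measurableSet_trimmedDomain (hΩ : IsCompact Ω) (hY : ∀ k, Y k ∈ Ω)
    (hstar : ∀ k, StarConvex ℝ (Y k) (voronoiCell Ω Y k)) {ε : ℝ} (hε : 0 ≤ ε) :
    MeasurableSet (trimmedDomain Ω Y ε) :=
  MeasurableSet.iUnion fun k => measurableSet_trimmedCell hΩ (hY k) (hstar k) hε

theorem trimmedDomain_subset (hΩ : IsCompact Ω) (hY : ∀ k, Y k ∈ Ω)
    (hstar : ∀ k, StarConvex ℝ (Y k) (voronoiCell Ω Y k)) {ε : ℝ} (hε : 0 ≤ ε) :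
    trimmedDomain Ω Y ε ⊆ Ω :=
  iUnion_subset fun k => (trimmedCell_subset hΩ (hY k) (hstar k) hε).trans fun _ h => h.1

/-- The points whose only nearest point is `Y k`, without `Y k` itself. -/
def openCell (Y : Fin K → Plane) (k : Fin K) : Set Plane :=
  {X | X ≠ Y k ∧ ∀ j, j ≠ k → ‖X - Y k‖ < ‖X - Y j‖}

theorem isOpen_openCell (Y : Fin K → Plane) (k : Fin K) : IsOpen (openCell Y k) := by
  have : openCell Y k = {Y k}ᶜ ∩ ⋂ j, {X | j ≠ k → ‖X - Y k‖ < ‖X - Y j‖} := by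
    ext X
    simp [openCell]
  rw [this]
  refine isOpen_compl_singleton.inter (isOpen_iInter_of_finite fun j => ?_)
  by_cases hj : j = k
  · simp [hj]
  · simp only [ne_eq, hj, not_false_eq_true, forall_const]
    exact isOpen_lt (by fun_prop) (by fun_prop)

/-- Ties between nearest points occur only on perpendicular bisectors, finitely many proper affine
subspaces and hence null. -/
theorem ae_exists_mem_openCell (hK : 0 < K) (hY : Function.Injective Y) :
    ∀ᵐ X : Plane, ∃ k, X ∈ openCell Y k := by
  have : Nonempty (Fin K) := ⟨⟨0, hK⟩⟩
  have h1 : ∀ᵐ X : Plane, ∀ k, X ≠ Y k :=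
    ae_all_iff.2 fun k => measure_eq_zero_iff_ae_notMem.1 (measure_singleton (Y k))
  have h2 : ∀ᵐ X : Plane, ∀ k j, j ≠ k → dist X (Y k) ≠ dist X (Y j) := by
    refine ae_all_iff.2 fun k => ae_all_iff.2 fun j => ?_
    by_cases hj : j = k
    · simp [hj]
    have h := Measure.addHaar_affineSubspace volume (AffineSubspace.perpBisector (Y k) (Y j))
      fun h => hj (hY (AffineSubspace.perpBisector_eq_top.1 h)).symm
    filter_upwards [measure_eq_zero_iff_ae_notMem.1 h] with X hX _ hd
    exact hX (AffineSubspace.mem_perpBisector_iff_dist_eq.2 hd)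
  filter_upwards [h1, h2] with X hX1 hX2
  obtain ⟨k, hk⟩ := Finite.exists_min fun k => ‖X - Y k‖
  refine ⟨k, hX1 k, fun j hj => lt_of_le_of_ne (hk j) ?_⟩
  simpa only [dist_eq_norm] using hX2 k j hj

theorem eq_of_mem_openCell {j : Fin K} {X : Plane} (hX : X ∈ openCell Y k)
    (hj : X ∈ voronoiCell Ω Y j) : j = k := by
  by_contra h
  exact absurd (hj.2 k) (not_le.2 (hX.2 j h))

/-- The area of a set which coincides with a part of the Voronoi cell on each open cell. -/
theorem volume_eq_sum_of_openCell (hK : 0 < K) (hY : Function.Injective Y) {Q : Set Plane}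
    {C : Fin K → Set Plane} (hC : ∀ k, MeasurableSet (C k))
    (hCD : ∀ k, C k ⊆ voronoiCell Ω Y k)
    (h : ∀ k, ∀ X ∈ openCell Y k, (X ∈ Q ↔ X ∈ C k)) :
    volume Q = ∑ k, volume (C k) := by
  have hae := ae_exists_mem_openCell hK hY
  have hQ : Q =ᵐ[volume] ⋃ k, C k := by
    filter_upwards [hae] with X ⟨k, hX⟩
    refine propext ((h k X hX).trans ⟨fun hk => mem_iUnion.2 ⟨k, hk⟩, fun hu => ?_⟩)
    obtain ⟨j, hj⟩ := mem_iUnion.1 hu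
    rwa [eq_of_mem_openCell hX (hCD j hj)] at hj
  rw [measure_congr hQ, measure_iUnion₀ (fun i j hij => ?_)
    fun k => (hC k).nullMeasurableSet, tsum_fintype]
  refine measure_eq_zero_iff_ae_notMem.2 ?_
  filter_upwards [hae] with X ⟨k, hX⟩ hX'
  exact hij ((eq_of_mem_openCell hX (hCD i hX'.1)).trans
    (eq_of_mem_openCell hX (hCD j hX'.2)).symm)

theorem hasGradientAt_norm_sub {y X : Plane} (h : X ≠ y) :
    HasGradientAt (fun Z => ‖Z - y‖) (‖X - y‖⁻¹ • (X - y)) X := by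
  have hpos : 0 < ‖X - y‖ := norm_pos_iff.2 (sub_ne_zero.2 h)
  have h1 : HasFDerivAt (fun Z : Plane => √(‖Z - y‖ ^ 2)) _ X :=
    ((hasFDerivAt_id X).sub_const y).norm_sq.sqrt (by positivity)
  simp only [Real.sqrt_sq (norm_nonneg _)] at h1
  rw [hasGradientAt_iff_hasFDerivAt]
  convert! h1 using 1
  ext Z
  simp
  field_simp

/-- The open cell is a neighbourhood of X on which the minimum is the distance to `Y k` alone. -/
theorem hasGradientAt_distTransform {X : Plane} (hX : X ∈ openCell Y k) :
    HasGradientAt (distTransform Y) (‖X - Y k‖⁻¹ • (X - Y k)) X := by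
  refine HasGradientAt.congr_of_eventuallyEq (hasGradientAt_norm_sub hX.1) ?_
  filter_upwards [(isOpen_openCell Y k).mem_nhds hX] with Z hZ
  have : Nonempty (Fin K) := ⟨k⟩
  refine le_antisymm (ciInf_le (finite_range _).bddBelow k) (le_ciInf fun j => ?_)
  by_cases hj : j = k
  · rw [hj]
  · exact (hZ.2 j hj).le

theorem measurable_distTransform (Y : Fin K → Plane) : Measurable (distTransform Y) :=
  Measurable.iInf fun k => by fun_prop

theorem measurable_gradient_distTransform (Y : Fin K → Plane) :
    Measurable (gradient (distTransform Y)) :=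
  (InnerProductSpace.toDual ℝ Plane).symm.continuous.measurable.comp
    (measurable_fderiv ℝ (distTransform Y))

theorem gradient_mem_sector_iff {X : Plane} (hX : X ∈ openCell Y k) (a b : ℝ) :
    gradient (distTransform Y) X ∈ sector a b ↔ X - Y k ∈ sector a b := by
  rw [(hasGradientAt_distTransform hX).gradient, smul_mem_sector]
  exact inv_pos.2 (norm_pos_iff.2 (sub_ne_zero.2 hX.1))

theorem exists_gradient_eq_dir_iff {X : Plane} (hX : X ∈ openCell Y k) (a b : ℝ) :
    (∃ t ∈ Icc a b, gradient (distTransform Y) X = dir t) ↔ X - Y k ∈ sector a b := by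
  have hpos : 0 < ‖X - Y k‖ := norm_pos_iff.2 (sub_ne_zero.2 hX.1)
  have hn : ‖gradient (distTransform Y) X‖ = 1 := by
    rw [(hasGradientAt_distTransform hX).gradient, norm_smul, norm_inv, norm_norm,
      inv_mul_cancel₀ hpos.ne']
  rw [← gradient_mem_sector_iff hX]
  constructor
  · rintro ⟨t, ht, h⟩
    exact ⟨⟨t, ht, by rw [hn, one_smul, h]⟩, fun h0 => by simp [mem_singleton_iff.1 h0] at hn⟩
  · rintro ⟨⟨t, ht, h⟩, -⟩
    exact ⟨t, ht, by rw [h, hn, one_smul]⟩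

end Cells

/-! ### Areas of orientation windows in the full and the trimmed domain -/

section Areas

variable {K : ℕ} {Ω : Set Plane} {Y : Fin K → Plane}

theorem voronoiCell_ray_iff (hΩ : IsCompact Ω) (hYΩ : ∀ k, Y k ∈ Ω)
    (hstar : ∀ k, StarConvex ℝ (Y k) (voronoiCell Ω Y k)) (k : Fin K) :
    ∀ r > 0, ∀ ω, Y k + r • dir ω ∈ voronoiCell Ω Y k ↔
      r ∈ Icc (0 * rayLength Ω Y k ω) (1 * rayLength Ω Y k ω) := fun r hr ω => by
  rw [mem_voronoiCell_iff hΩ (hYΩ k) (hstar k) hr.le]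
  simp [hr.le]

theorem domain_iff_of_mem_openCell {k : Fin K} {X : Plane} (hX : X ∈ openCell Y k) :
    X ∈ Ω ↔ X ∈ voronoiCell Ω Y k := by
  refine ⟨fun h => ⟨h, fun j => ?_⟩, fun h => h.1⟩
  by_cases hj : j = k
  · rw [hj]
  · exact (hX.2 j hj).le

theorem trimmedDomain_iff_of_mem_openCell (hΩ : IsCompact Ω) (hYΩ : ∀ k, Y k ∈ Ω)
    (hstar : ∀ k, StarConvex ℝ (Y k) (voronoiCell Ω Y k)) {ε : ℝ} (hε : 0 ≤ ε) {k : Fin K}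
    {X : Plane} (hX : X ∈ openCell Y k) :
    X ∈ trimmedDomain Ω Y ε ↔ X ∈ trimmedCell Ω Y ε k := by
  refine ⟨fun h => ?_, fun h => mem_iUnion.2 ⟨k, h⟩⟩
  obtain ⟨j, hj⟩ := mem_iUnion.1 h
  rwa [eq_of_mem_openCell hX (trimmedCell_subset hΩ (hYΩ j) (hstar j) hε hj)] at hj

/-- On each ray ∫ r dr from εR to (1-ε)R is (1-2ε)R²/2, the fraction 1-2ε of the untrimmed value. -/
theorem volume_trimmedDomain (hK : 0 < K) (hΩ : IsCompact Ω) (hY : Function.Injective Y)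
    (hYΩ : ∀ k, Y k ∈ Ω) (hstar : ∀ k, StarConvex ℝ (Y k) (voronoiCell Ω Y k))
    {ε : ℝ} (hε : 0 ≤ ε) (hε' : ε ≤ 1 / 2) :
    volume (trimmedDomain Ω Y ε) = ENNReal.ofReal (1 - 2 * ε) * volume Ω := by
  rw [volume_eq_sum_of_openCell hK hY (fun k => measurableSet_trimmedCell hΩ (hYΩ k) (hstar k) hε)
      (fun k => trimmedCell_subset hΩ (hYΩ k) (hstar k) hε)
      (fun k X hX => trimmedDomain_iff_of_mem_openCell hΩ hYΩ hstar hε hX),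
    volume_eq_sum_of_openCell hK hY (fun k => (isCompact_voronoiCell hΩ k).measurableSet)
      (fun k => subset_rfl) (fun k X hX => domain_iff_of_mem_openCell hX), Finset.mul_sum]
  refine Finset.sum_congr rfl fun k _ => ?_
  rw [volume_annular (measurableSet_trimmedCell hΩ (hYΩ k) (hstar k) hε) hε
      (by linarith : ε ≤ 1 - ε) rayLength_nonneg (fun r hr ω => mem_trimmedCell_iff hε hr ω) 0,
    volume_annular (isCompact_voronoiCell hΩ k).measurableSet le_rfl zero_le_one
      rayLength_nonneg (voronoiCell_ray_iff hΩ hYΩ hstar k) 0,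
    ← lintegral_const_mul' _ _ ENNReal.ofReal_ne_top]
  refine lintegral_congr fun ω => ?_
  rw [← ENNReal.ofReal_mul (by linarith)]
  congr 1
  ring

variable {a b : ℝ}

theorem measurable_sum_rayLength (hΩ : IsCompact Ω) (hYΩ : ∀ k, Y k ∈ Ω)
    (hstar : ∀ k, StarConvex ℝ (Y k) (voronoiCell Ω Y k)) :
    Measurable fun ω => ∑ k, rayLength Ω Y k ω ^ 2 / 2 :=
  Finset.measurable_sum _ fun k _ =>
    ((measurable_rayLength hΩ (hYΩ k) (hstar k)).pow_const 2).div_const 2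

theorem lintegral_ofReal_sum_rayLength (hΩ : IsCompact Ω) (hYΩ : ∀ k, Y k ∈ Ω)
    (hstar : ∀ k, StarConvex ℝ (Y k) (voronoiCell Ω Y k)) {c : ℝ} (hc : 0 ≤ c) :
    ∑ k, ∫⁻ ω in Icc a b, ENNReal.ofReal (c * (rayLength Ω Y k ω ^ 2 / 2)) =
      ENNReal.ofReal c *
        ∫⁻ ω in Icc a b, ENNReal.ofReal (∑ k, rayLength Ω Y k ω ^ 2 / 2) := by
  rw [← lintegral_const_mul' _ _ ENNReal.ofReal_ne_top, ← lintegral_finsetSum]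
  · refine lintegral_congr fun ω => ?_
    rw [← ENNReal.ofReal_mul hc, Finset.mul_sum, ENNReal.ofReal_sum_of_nonneg]
    intro k _
    positivity
  · intro k _
    exact ((((measurable_rayLength hΩ (hYΩ k) (hstar k)).pow_const 2).div_const 2).const_mul
      c).ennreal_ofReal

theorem measurableSet_sub_mem_sector (y : Plane) : MeasurableSet {X | X - y ∈ sector a b} :=
  measurable_id.sub_const y (measurableSet_sector a b)

theorem volume_gradient_orientation (hK : 0 < K) (hΩ : IsCompact Ω) (hY : Function.Injective Y)
    (hYΩ : ∀ k, Y k ∈ Ω) (hstar : ∀ k, StarConvex ℝ (Y k) (voronoiCell Ω Y k))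
    (hab : a ≤ b) (hb : b < a + 2 * π) :
    volume {X | X ∈ Ω ∧ DifferentiableAt ℝ (distTransform Y) X ∧
        ∃ t ∈ Icc a b, gradient (distTransform Y) X = dir t} =
      ∫⁻ ω in Icc a b, ENNReal.ofReal (∑ k, rayLength Ω Y k ω ^ 2 / 2) := by
  rw [volume_eq_sum_of_openCell (Ω := Ω) hK hY
    (C := fun k => voronoiCell Ω Y k ∩ {X | X - Y k ∈ sector a b})
    (fun k => (isCompact_voronoiCell hΩ k).measurableSet.inter (measurableSet_sub_mem_sector _))
    (fun k => inter_subset_left) (fun k X hX => ?_)]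
  · simp only [volume_annular_sector (isCompact_voronoiCell hΩ _).measurableSet le_rfl zero_le_one
      rayLength_nonneg (voronoiCell_ray_iff hΩ hYΩ hstar _) hab hb]
    rw [lintegral_ofReal_sum_rayLength hΩ hYΩ hstar (by norm_num)]
    simp
  · rw [mem_ofPred_eq, exists_gradient_eq_dir_iff hX, domain_iff_of_mem_openCell hX]
    exact ⟨fun h => ⟨h.1, h.2.2⟩,
      fun h => ⟨h.1, (hasGradientAt_distTransform hX).differentiableAt, h.2⟩⟩

/-- Trimming keeps the same fraction 1-2ε of area in every orientation, so it does not distort the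
distribution of orientations. -/
theorem volume_trimmedDomain_gradient (hK : 0 < K) (hΩ : IsCompact Ω) (hY : Function.Injective Y)
    (hYΩ : ∀ k, Y k ∈ Ω) (hstar : ∀ k, StarConvex ℝ (Y k) (voronoiCell Ω Y k))
    {ε : ℝ} (hε : 0 ≤ ε) (hε' : ε ≤ 1 / 2) (hab : a ≤ b) (hb : b < a + 2 * π) :
    volume (trimmedDomain Ω Y ε ∩ gradient (distTransform Y) ⁻¹' sector a b) =
      ENNReal.ofReal (1 - 2 * ε) *
        ∫⁻ ω in Icc a b, ENNReal.ofReal (∑ k, rayLength Ω Y k ω ^ 2 / 2) := by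
  have hm := fun k => measurableSet_trimmedCell hΩ (hYΩ k) (hstar k) hε
  rw [volume_eq_sum_of_openCell (Ω := Ω) hK hY
    (C := fun k => trimmedCell Ω Y ε k ∩ {X | X - Y k ∈ sector a b})
    (fun k => (hm k).inter (measurableSet_sub_mem_sector _))
    (fun k => inter_subset_left.trans (trimmedCell_subset hΩ (hYΩ k) (hstar k) hε))
    (fun k X hX => ?_)]
  · simp only [volume_annular_sector (hm _) hε (by linarith : ε ≤ 1 - ε)
      rayLength_nonneg (fun r hr ω => mem_trimmedCell_iff hε hr ω) hab hb]
    rw [← lintegral_ofReal_sum_rayLength hΩ hYΩ hstar (by linarith),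
      show (1 - ε) ^ 2 - ε ^ 2 = 1 - 2 * ε by ring]
  · rw [mem_inter_iff, mem_preimage, gradient_mem_sector_iff hX,
      trimmedDomain_iff_of_mem_openCell hΩ hYΩ hstar hε hX]
    rfl

/-- Finiteness is free: the integral is the area of a subset of the compact Ω. -/
theorem integrableOn_sum_rayLength (hK : 0 < K) (hΩ : IsCompact Ω) (hY : Function.Injective Y)
    (hYΩ : ∀ k, Y k ∈ Ω) (hstar : ∀ k, StarConvex ℝ (Y k) (voronoiCell Ω Y k))
    (hab : a ≤ b) (hb : b < a + 2 * π) :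
    IntegrableOn (fun ω => ∑ k, rayLength Ω Y k ω ^ 2 / 2) (Icc a b) := by
  refine ⟨(measurable_sum_rayLength hΩ hYΩ hstar).aestronglyMeasurable, ?_⟩
  rw [hasFiniteIntegral_iff_ofReal (Eventually.of_forall fun ω =>
      Finset.sum_nonneg fun k _ => by positivity),
    ← volume_gradient_orientation hK hΩ hY hYΩ hstar hab hb]
  exact (measure_mono fun X hX => hX.1).trans_lt hΩ.measure_lt_top

theorem integral_sum_rayLength (hΩ : IsCompact Ω)
    (hYΩ : ∀ k, Y k ∈ Ω) (hstar : ∀ k, StarConvex ℝ (Y k) (voronoiCell Ω Y k)) :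
    ∫ ω in Icc a b, ∑ k, rayLength Ω Y k ω ^ 2 / 2 =
      (∫⁻ ω in Icc a b, ENNReal.ofReal (∑ k, rayLength Ω Y k ω ^ 2 / 2)).toReal :=
  integral_eq_lintegral_of_nonneg_ae
    (Eventually.of_forall fun ω => Finset.sum_nonneg fun k _ => by positivity)
    (measurable_sum_rayLength hΩ hYΩ hstar).aestronglyMeasurable

end Areas

/-! ### The small-lag limit of the correlation of the wave -/

section Correlation

variable {E : Type*} [NormedAddCommGroup E] [InnerProductSpace ℝ E] [FiniteDimensional ℝ E]
  [MeasurableSpace E] [BorelSpace E]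

/-- The wave function `exp(i S / τ)` on the set `A`. -/
noncomputable def wave (A : Set E) (S : E → ℝ) (τ : ℝ) : E → ℂ :=
  A.indicator fun x => Complex.exp (Complex.I * (S x : ℂ) / (τ : ℂ))

variable {A : Set E} {S : E → ℝ}

theorem memLp_wave (hA : MeasurableSet A) (hA' : volume A ≠ ∞) (hS : Measurable S) (τ : ℝ)
    (p : ℝ≥0∞) : MemLp (wave A S τ) p := by
  have hfin : IsFiniteMeasure (volume.restrict A) := isFiniteMeasure_restrict.2 hA'
  refine (memLp_indicator_iff_restrict hA).2 (MemLp.of_bound ?_ 1 ?_)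
  · exact Measurable.aestronglyMeasurable (by fun_prop)
  · refine Eventually.of_forall fun x => ?_
    rw [show Complex.I * (S x : ℂ) / (τ : ℂ) = ((S x / τ : ℝ) : ℂ) * Complex.I by push_cast; ring,
      Complex.norm_exp_ofReal_mul_I]

theorem integral_wave_mul_conj (hA : MeasurableSet A) (τ : ℝ) (h : E) :
    ∫ x, wave A S τ (x + h) * (starRingEnd ℂ) (wave A S τ x) =
      ∫ x in A ∩ (· + h) ⁻¹' A,
        Complex.exp (((S (x + h) - S x) / τ : ℝ) * Complex.I) := by
  rw [← integral_indicator (hA.inter (measurable_add_const h hA))]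
  refine integral_congr_ae (Eventually.of_forall fun x => ?_)
  beta_reduce
  by_cases h1 : x ∈ A
  · by_cases h2 : x + h ∈ A
    · rw [indicator_of_mem (show x ∈ A ∩ (· + h) ⁻¹' A from ⟨h1, h2⟩), wave,
        indicator_of_mem h1, indicator_of_mem h2, ← Complex.exp_conj, ← Complex.exp_add]
      congr 1
      simp
      ring
    · rw [indicator_of_notMem (fun hx : x ∈ A ∩ (· + h) ⁻¹' A => h2 hx.2), wave,
        indicator_of_notMem h2, zero_mul]
  · rw [indicator_of_notMem (fun hx : x ∈ A ∩ (· + h) ⁻¹' A => h1 hx.1), wave,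
      indicator_of_notMem h1, map_zero, mul_zero]

/-- Translation is continuous in measure. This disposes of the points of A whose translate leaves A.
-/
theorem tendsto_measure_diff_translate (hA : MeasurableSet A) (hA' : volume A ≠ ∞) (ξ : E) :
    Tendsto (fun τ : ℝ => volume (A \ (· + τ • ξ) ⁻¹' A)) (𝓝 0) (𝓝 0) := by
  let F : ℝ → C(E, E) := fun τ => ⟨fun x => x + τ • ξ, by fun_prop⟩
  have hF : Continuous F :=
    ContinuousMap.continuous_of_continuous_uncurry _ (by
      change Continuous fun p : ℝ × E => p.2 + p.1 • ξ
      fun_prop)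
  have key := tendsto_measure_symmDiff_preimage_nhds_zero (hF.tendsto 0)
    (Eventually.of_forall fun τ => measurePreserving_add_right volume (τ • ξ))
    (measurePreserving_add_right volume ((0 : ℝ) • ξ)) hA.nullMeasurableSet hA'
  refine tendsto_of_tendsto_of_tendsto_of_le_of_le tendsto_const_nhds key
    (fun _ => zero_le) fun τ => measure_mono fun x hx => Or.inr ⟨?_, hx.2⟩
  change x + (0 : ℝ) • ξ ∈ A
  simpa using hx.1

/-- The correlation of the wave function at the distance `τ ξ` tends to the characteristic
function of the distribution of the gradient of the phase. -/
theorem tendsto_integral_wave_mul_conj (hA : MeasurableSet A) (hA' : volume A ≠ ∞)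
    (hS : Measurable S) {G : E → E} (hG : ∀ᵐ x, HasGradientAt S (G x) x) (ξ : E) :
    Tendsto (fun τ : ℝ => ∫ x, wave A S τ (x + τ • ξ) * (starRingEnd ℂ) (wave A S τ x))
      (𝓝[≠] 0) (𝓝 (∫ x in A, Complex.exp ((inner ℝ (G x) ξ : ℝ) * Complex.I))) := by
  have hfin : IsFiniteMeasure (volume.restrict A) := isFiniteMeasure_restrict.2 hA'
  let e : ℝ → E → ℂ := fun τ x => Complex.exp (((S (x + τ • ξ) - S x) / τ : ℝ) * Complex.I)
  have he : ∀ τ, Measurable (e τ) := fun τ => by fun_prop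
  have hen : ∀ τ x, ‖e τ x‖ = 1 := fun τ x => Complex.norm_exp_ofReal_mul_I _
  have hei : ∀ τ, IntegrableOn (e τ) A := fun τ =>
    Integrable.of_bound (he τ).aestronglyMeasurable 1 (Eventually.of_forall fun x => (hen τ x).le)
  have h1 : Tendsto (fun τ : ℝ => ∫ x in A, e τ x) (𝓝[≠] 0)
      (𝓝 (∫ x in A, Complex.exp ((inner ℝ (G x) ξ : ℝ) * Complex.I))) := by
    refine tendsto_integral_filter_of_dominated_convergence (fun _ => 1)
      (Eventually.of_forall fun τ => (he τ).aestronglyMeasurable)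
      (Eventually.of_forall fun τ => Eventually.of_forall fun x => (hen τ x).le)
      (integrable_const 1) (ae_restrict_of_ae ?_)
    filter_upwards [hG] with x hx
    -- The quotient at x is a slope in the direction ξ; this is why the lag is scaled by the same τ
    -- as the phase.
    have hd := (hx.hasFDerivAt.hasLineDerivAt ξ).tendsto_slope_zero
    have hlim : Tendsto (fun τ : ℝ => (S (x + τ • ξ) - S x) / τ) (𝓝[≠] 0)
        (𝓝 (inner ℝ (G x) ξ)) := by
      simpa [div_eq_inv_mul] using hd
    exact (Complex.continuous_exp.comp (Complex.continuous_ofReal.mul continuous_const)).continuousAt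
      |>.tendsto.comp hlim
  have h2 : Tendsto (fun τ : ℝ => ∫ x in A \ (· + τ • ξ) ⁻¹' A, e τ x) (𝓝[≠] 0) (𝓝 0) := by
    refine squeeze_zero_norm (fun τ => ?_)
      ((ENNReal.tendsto_toReal ENNReal.zero_ne_top).comp
        ((tendsto_measure_diff_translate hA hA' ξ).mono_left nhdsWithin_le_nhds))
    refine (norm_setIntegral_le_of_norm_le_const
      ((measure_mono sdiff_subset).trans_lt hA'.lt_top) fun x _ => (hen τ x).le).trans ?_
    rw [one_mul]
    rfl
  have h3 := h1.sub h2
  rw [sub_zero] at h3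
  refine h3.congr fun τ => ?_
  rw [integral_wave_mul_conj hA, sub_eq_iff_eq_add,
    integral_inter_add_sdiff (measurable_add_const (τ • ξ) hA) (hei τ)]

end Correlation

open scoped FourierTransform

/-! ### The spectral measure, its weak limit and its mass on sectors -/

section Spectrum

variable {K : ℕ} {Ω : Set Plane} {Y : Fin K → Plane} {ε τ : ℝ}

theorem waveTransform_eq_fourier (hA : MeasurableSet (trimmedDomain Ω Y ε)) (hτ : τ ≠ 0)
    (U : Plane) :
    waveTransform Ω Y ε τ (U 0) (U 1) =
      (1 / (2 * π * τ * √(area (trimmedDomain Ω Y ε))) : ℝ) *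
        𝓕 (wave (trimmedDomain Ω Y ε) (distTransform Y) τ) ((2 * π * τ)⁻¹ • U) := by
  rw [waveTransform, Real.fourier_eq']
  congr 1
  rw [← integral_indicator hA]
  refine integral_congr_ae (Eventually.of_forall fun X => ?_)
  beta_reduce
  by_cases hX : X ∈ trimmedDomain Ω Y ε
  · rw [wave, indicator_of_mem hX, indicator_of_mem hX, smul_eq_mul, mul_comm]
    congr 2
    have hπ := Real.pi_ne_zero
    have hin : inner ℝ X ((2 * π * τ)⁻¹ • U) = (2 * π * τ)⁻¹ * (U 0 * X 0 + U 1 * X 1) := by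
      rw [inner_smul_right, PiLp.inner_apply, Fin.sum_univ_two]
      simp
    rw [hin, show -2 * π * ((2 * π * τ)⁻¹ * (U 0 * X 0 + U 1 * X 1)) =
      -(U 0 * X 0 + U 1 * X 1) / τ by field_simp]
    push_cast
    ring
  · rw [wave, indicator_of_notMem hX, indicator_of_notMem hX, smul_zero]

/-- The measure of the plane whose density is the power spectrum. -/
noncomputable def spectralMeasure {K : ℕ} (Ω : Set Plane) (Y : Fin K → Plane) (ε τ : ℝ) :
    Measure Plane :=
  volume.withDensity fun U => ENNReal.ofReal (‖waveTransform Ω Y ε τ (U 0) (U 1)‖ ^ 2)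

theorem norm_sq_waveTransform (hA : MeasurableSet (trimmedDomain Ω Y ε)) (hτ : τ ≠ 0)
    (U : Plane) :
    ‖waveTransform Ω Y ε τ (U 0) (U 1)‖ ^ 2 =
      ((2 * π * τ) ^ 2 * area (trimmedDomain Ω Y ε))⁻¹ *
        ‖𝓕 (wave (trimmedDomain Ω Y ε) (distTransform Y) τ) ((2 * π * τ)⁻¹ • U)‖ ^ 2 := by
  rw [waveTransform_eq_fourier hA hτ, norm_mul, mul_pow, Complex.norm_real, Real.norm_eq_abs,
    sq_abs, one_div, inv_pow, mul_pow _ (√_), Real.sq_sqrt (show 0 ≤ area _ from ENNReal.toReal_nonneg)]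

theorem continuous_norm_sq_waveTransform (hA : MeasurableSet (trimmedDomain Ω Y ε))
    (hA' : volume (trimmedDomain Ω Y ε) ≠ ∞) (hτ : τ ≠ 0) :
    Continuous fun U : Plane => ‖waveTransform Ω Y ε τ (U 0) (U 1)‖ ^ 2 := by
  simp only [norm_sq_waveTransform hA hτ]
  have : Continuous (𝓕 (wave (trimmedDomain Ω Y ε) (distTransform Y) τ)) :=
    VectorFourier.fourierIntegral_continuous Real.continuous_fourierChar
      (by exact continuous_inner)
      (memLp_one_iff_integrable.1 (memLp_wave hA hA' (measurable_distTransform Y) τ 1))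
  fun_prop

theorem integrable_norm_sq_waveTransform (hA : MeasurableSet (trimmedDomain Ω Y ε))
    (hA' : volume (trimmedDomain Ω Y ε) ≠ ∞) (hτ : τ ≠ 0) :
    Integrable fun U : Plane => ‖waveTransform Ω Y ε τ (U 0) (U 1)‖ ^ 2 := by
  simp only [norm_sq_waveTransform hA hτ]
  have hm := memLp_wave hA hA' (measurable_distTransform Y) τ
  have hc : (2 * π * τ)⁻¹ ≠ 0 := by
    have := Real.pi_ne_zero
    positivity
  exact ((integrable_norm_sq_fourier (memLp_one_iff_integrable.1 (hm 1)) (hm 2)).comp_smul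
    hc).const_mul _

theorem isFiniteMeasure_spectralMeasure (hA : MeasurableSet (trimmedDomain Ω Y ε))
    (hA' : volume (trimmedDomain Ω Y ε) ≠ ∞) (hτ : τ ≠ 0) :
    IsFiniteMeasure (spectralMeasure Ω Y ε τ) :=
  isFiniteMeasure_withDensity_ofReal (integrable_norm_sq_waveTransform hA hA' hτ).2

/-- The characteristic function of the spectral measure is the correlation of the wave
function. -/
theorem charFun_spectralMeasure (hA : MeasurableSet (trimmedDomain Ω Y ε))
    (hA' : volume (trimmedDomain Ω Y ε) ≠ ∞) (hτ : τ ≠ 0) (ξ : Plane) :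
    charFun (spectralMeasure Ω Y ε τ) ξ = ((area (trimmedDomain Ω Y ε))⁻¹ : ℝ) *
      ∫ X, wave (trimmedDomain Ω Y ε) (distTransform Y) τ (X + τ • ξ) *
        (starRingEnd ℂ) (wave (trimmedDomain Ω Y ε) (distTransform Y) τ X) := by
  have hm := memLp_wave hA hA' (measurable_distTransform Y) τ
  set g := wave (trimmedDomain Ω Y ε) (distTransform Y) τ with hg
  have hπ := Real.pi_ne_zero
  have hc : 2 * π * τ ≠ 0 := by positivity
  rw [← integral_fourierChar_mul_norm_sq_fourier (memLp_one_iff_integrable.1 (hm 1)) (hm 2)]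
  -- The Jacobian (2πτ)² of the frequency scaling cancels the normalization of the transform,
  -- leaving only the inverse area.
  have hscale := Measure.integral_comp_inv_smul (volume : Measure Plane)
    (fun w => (Real.fourierChar (inner ℝ (τ • ξ) w) : ℂ) * ((‖𝓕 g w‖ ^ 2 : ℝ) : ℂ)) (2 * π * τ)
  rw [finrank_euclideanSpace_fin, abs_of_nonneg (sq_nonneg _)] at hscale
  rw [charFun_apply, spectralMeasure, integral_withDensity_eq_integral_toReal_smul
    (continuous_norm_sq_waveTransform hA hA' hτ).measurable.ennreal_ofReal
    (Eventually.of_forall fun _ => ENNReal.ofReal_lt_top)]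
  calc ∫ U : Plane, (ENNReal.ofReal (‖waveTransform Ω Y ε τ (U 0) (U 1)‖ ^ 2)).toReal •
        Complex.exp ((inner ℝ U ξ : ℝ) * Complex.I)
      = ∫ U : Plane, ((((2 * π * τ) ^ 2 * area (trimmedDomain Ω Y ε))⁻¹ : ℝ) : ℂ) *
          ((Real.fourierChar (inner ℝ (τ • ξ) ((2 * π * τ)⁻¹ • U)) : ℂ) *
            ((‖𝓕 g ((2 * π * τ)⁻¹ • U)‖ ^ 2 : ℝ) : ℂ)) := by
        refine integral_congr_ae (Eventually.of_forall fun U => ?_)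
        beta_reduce
        rw [ENNReal.toReal_ofReal (sq_nonneg _), norm_sq_waveTransform hA hτ, ← hg,
          Complex.real_smul, Real.fourierChar_apply, inner_smul_left, inner_smul_right,
          real_inner_comm, show 2 * π * ((starRingEnd ℝ) τ * ((2 * π * τ)⁻¹ * inner ℝ ξ U)) =
            inner ℝ ξ U by simp; field_simp]
        push_cast
        ring
    _ = _ := by
        rw [integral_const_mul, hscale, Complex.real_smul, ← mul_assoc, ← Complex.ofReal_mul]
        congr 2
        rw [mul_inv, mul_right_comm, inv_mul_cancel₀ (pow_ne_zero 2 hc), one_mul]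

/-- The total mass is the characteristic function at 0; at zero lag the correlation is the area of
Ω^ε. -/
theorem isProbabilityMeasure_spectralMeasure (hA : MeasurableSet (trimmedDomain Ω Y ε))
    (hA' : volume (trimmedDomain Ω Y ε) ≠ ∞) (hA0 : volume (trimmedDomain Ω Y ε) ≠ 0)
    (hτ : τ ≠ 0) : IsProbabilityMeasure (spectralMeasure Ω Y ε τ) := by
  have := isFiniteMeasure_spectralMeasure hA hA' hτ
  have h := charFun_spectralMeasure hA hA' hτ 0
  simp only [smul_zero] at h
  rw [charFun_zero, integral_wave_mul_conj hA] at h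
  simp only [add_zero, sub_self, zero_div, Complex.ofReal_zero, zero_mul, Complex.exp_zero,
    preimage_id', inter_self, setIntegral_const, Complex.real_smul, mul_one] at h
  rw [← Complex.ofReal_mul] at h
  have h1 : (spectralMeasure Ω Y ε τ).real univ = 1 := by
    have h' := Complex.ofReal_injective h
    rw [h']
    exact inv_mul_cancel₀ (ENNReal.toReal_ne_zero.2 ⟨hA0, hA'⟩)
  refine ⟨?_⟩
  rw [← ENNReal.toReal_eq_one_iff]
  exact h1

/-- The distribution of the gradient of the distance transform on the trimmed domain. -/
noncomputable def gradientLaw {K : ℕ} (Ω : Set Plane) (Y : Fin K → Plane) (ε : ℝ) :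
    Measure Plane :=
  (ProbabilityTheory.cond volume (trimmedDomain Ω Y ε)).map (gradient (distTransform Y))

theorem isProbabilityMeasure_gradientLaw
    (hA' : volume (trimmedDomain Ω Y ε) ≠ ∞) (hA0 : volume (trimmedDomain Ω Y ε) ≠ 0) :
    IsProbabilityMeasure (gradientLaw Ω Y ε) := by
  have := ProbabilityTheory.cond_isProbabilityMeasure_of_finite hA0 hA'
  exact Measure.isProbabilityMeasure_map (measurable_gradient_distTransform Y).aemeasurable

theorem charFun_gradientLaw (ξ : Plane) :
    charFun (gradientLaw Ω Y ε) ξ = ((area (trimmedDomain Ω Y ε))⁻¹ : ℝ) *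
      ∫ X in trimmedDomain Ω Y ε,
        Complex.exp ((inner ℝ (gradient (distTransform Y) X) ξ : ℝ) * Complex.I) := by
  rw [charFun_apply, gradientLaw,
    integral_map (measurable_gradient_distTransform Y).aemeasurable
      (Measurable.aestronglyMeasurable (by fun_prop)),
    ProbabilityTheory.cond, integral_smul_measure, ENNReal.toReal_inv, Complex.real_smul]
  rfl

theorem tendsto_charFun_spectralMeasure (hK : 0 < K) (hY : Function.Injective Y)
    (hA : MeasurableSet (trimmedDomain Ω Y ε)) (hA' : volume (trimmedDomain Ω Y ε) ≠ ∞)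
    (ξ : Plane) :
    Tendsto (fun τ => charFun (spectralMeasure Ω Y ε τ) ξ) (𝓝[≠] 0)
      (𝓝 (charFun (gradientLaw Ω Y ε) ξ)) := by
  rw [charFun_gradientLaw]
  refine ((tendsto_integral_wave_mul_conj hA hA' (measurable_distTransform Y) ?_ ξ).const_mul
    _).congr' ?_
  · filter_upwards [ae_exists_mem_openCell hK hY] with X ⟨k, hX⟩
    exact (hasGradientAt_distTransform hX).differentiableAt.hasGradientAt
  · filter_upwards [self_mem_nhdsWithin] with τ hτ
    exact (charFun_spectralMeasure hA hA' hτ ξ).symm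

theorem gradientLaw_apply (hA : MeasurableSet (trimmedDomain Ω Y ε)) {s : Set Plane}
    (hs : MeasurableSet s) :
    gradientLaw Ω Y ε s = (volume (trimmedDomain Ω Y ε))⁻¹ *
      volume (trimmedDomain Ω Y ε ∩ gradient (distTransform Y) ⁻¹' s) := by
  rw [gradientLaw, Measure.map_apply (measurable_gradient_distTransform Y) hs,
    ProbabilityTheory.cond_apply hA]

/-- The spectral measures converge on each set whose frontier is negligible for the distribution
of the gradient. -/
theorem tendsto_spectralMeasure (hK : 0 < K) (hY : Function.Injective Y)
    (hA : MeasurableSet (trimmedDomain Ω Y ε)) (hA' : volume (trimmedDomain Ω Y ε) ≠ ∞)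
    (hA0 : volume (trimmedDomain Ω Y ε) ≠ 0) {s : Set Plane}
    (hs : gradientLaw Ω Y ε (frontier s) = 0) :
    Tendsto (fun τ => spectralMeasure Ω Y ε τ s) (𝓝[≠] 0) (𝓝 (gradientLaw Ω Y ε s)) := by
  classical
  let ν : ProbabilityMeasure Plane :=
    ⟨gradientLaw Ω Y ε, isProbabilityMeasure_gradientLaw hA' hA0⟩
  -- At τ = 0 division by zero makes the transform vanish, so the spectral measure is not a
  -- probability measure there. The value `ν` is a filler that the punctured filter does not see.
  let μ : ℝ → ProbabilityMeasure Plane := fun τ =>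
    if h : τ ≠ 0 then
      ⟨spectralMeasure Ω Y ε τ, isProbabilityMeasure_spectralMeasure hA hA' hA0 h⟩
    else ν
  have hμ : ∀ τ ≠ 0, (μ τ : Measure Plane) = spectralMeasure Ω Y ε τ := fun τ h => by
    have h' : μ τ = ⟨_, isProbabilityMeasure_spectralMeasure hA hA' hA0 h⟩ := dif_pos h
    rw [h']
    rfl
  have hlim : Tendsto μ (𝓝[≠] 0) (𝓝 ν) := by
    refine tendsto_probabilityMeasure_of_tendsto_charFun fun ξ => ?_
    refine (tendsto_charFun_spectralMeasure hK hY hA hA' ξ).congr' ?_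
    filter_upwards [self_mem_nhdsWithin] with τ hτ
    rw [hμ τ hτ]
  refine (ProbabilityMeasure.tendsto_measure_of_null_frontier_of_tendsto' hlim hs).congr' ?_
  filter_upwards [self_mem_nhdsWithin] with τ hτ
  rw [hμ τ hτ]

/-- The factor 1-2ε occurs in the area of the window and in the total area; it is nonzero and
cancels. -/
theorem gradientLaw_sector (hK : 0 < K) (hΩ : IsCompact Ω) (hY : Function.Injective Y)
    (hYΩ : ∀ k, Y k ∈ Ω) (hstar : ∀ k, StarConvex ℝ (Y k) (voronoiCell Ω Y k))
    (hε : 0 < ε) (hε' : ε < 1 / 2) {a b : ℝ} (hab : a ≤ b) (hb : b < a + 2 * π) :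
    gradientLaw Ω Y ε (sector a b) = (volume Ω)⁻¹ *
      ∫⁻ ω in Icc a b, ENNReal.ofReal (∑ k, rayLength Ω Y k ω ^ 2 / 2) := by
  have hc : ENNReal.ofReal (1 - 2 * ε) ≠ 0 := by
    rw [ne_eq, ENNReal.ofReal_eq_zero]
    linarith
  rw [gradientLaw_apply (measurableSet_trimmedDomain hΩ hYΩ hstar hε.le)
      (measurableSet_sector a b),
    volume_trimmedDomain_gradient hK hΩ hY hYΩ hstar hε.le hε'.le hab hb,
    volume_trimmedDomain hK hΩ hY hYΩ hstar hε.le hε'.le,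
    ENNReal.mul_inv (Or.inl hc) (Or.inl ENNReal.ofReal_ne_top), mul_mul_mul_comm,
    ENNReal.inv_mul_cancel hc ENNReal.ofReal_ne_top, one_mul]

theorem gradientLaw_frontier_sector (hK : 0 < K) (hΩ : IsCompact Ω) (hY : Function.Injective Y)
    (hYΩ : ∀ k, Y k ∈ Ω) (hstar : ∀ k, StarConvex ℝ (Y k) (voronoiCell Ω Y k))
    (hε : 0 < ε) (hε' : ε < 1 / 2) {a b : ℝ} (hab : a ≤ b) (hb : b < a + 2 * π) :
    gradientLaw Ω Y ε (frontier (sector a b)) = 0 := by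
  have hπ := Real.two_pi_pos
  -- A boundary ray is a sector with one orientation, so its mass is an integral over a single
  -- point.
  have hray : ∀ t, gradientLaw Ω Y ε (sector t t) = 0 := fun t => by
    rw [gradientLaw_sector hK hΩ hY hYΩ hstar hε hε' le_rfl (by linarith), Icc_self,
      Measure.restrict_singleton]
    simp
  have h0 : gradientLaw Ω Y ε {0} = 0 := by
    rw [gradientLaw_apply (measurableSet_trimmedDomain hΩ hYΩ hstar hε.le)
      (measurableSet_singleton 0)]
    have : volume (trimmedDomain Ω Y ε ∩ gradient (distTransform Y) ⁻¹' {0}) = 0 := by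
      refine measure_eq_zero_iff_ae_notMem.2 ?_
      filter_upwards [ae_exists_mem_openCell hK hY] with X ⟨k, hX⟩ hX'
      have h := hX'.2
      rw [mem_preimage, mem_singleton_iff, (hasGradientAt_distTransform hX).gradient,
        smul_eq_zero, inv_eq_zero, norm_eq_zero, or_self, sub_eq_zero] at h
      exact hX.1 h
    rw [this, mul_zero]
  exact measure_mono_null (frontier_sector_subset hab hb)
    (measure_union_null (measure_union_null h0 (hray a)) (hray b))

theorem powerSpectrum_eq (r ω : ℝ) :
    powerSpectrum Ω Y ε τ r ω =
      ‖waveTransform Ω Y ε τ ((r • dir ω : Plane) 0) ((r • dir ω : Plane) 1)‖ ^ 2 := by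
  simp [powerSpectrum, dir_apply_zero, dir_apply_one]

theorem measurable_powerSpectrum_mul (hA : MeasurableSet (trimmedDomain Ω Y ε))
    (hA' : volume (trimmedDomain Ω Y ε) ≠ ∞) (hτ : τ ≠ 0) :
    Measurable fun p : ℝ × ℝ => powerSpectrum Ω Y ε τ p.1 p.2 * p.1 := by
  simp only [powerSpectrum_eq]
  have h := (continuous_norm_sq_waveTransform hA hA' hτ).comp
    (continuous_fst.smul (continuous_dir.comp continuous_snd) :
      Continuous fun p : ℝ × ℝ => p.1 • dir p.2)
  exact (h.mul continuous_fst).measurable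

/-- The weight r in the integral of the theorem is the polar Jacobian. -/
theorem spectralMeasure_sector (hA : MeasurableSet (trimmedDomain Ω Y ε))
    (hA' : volume (trimmedDomain Ω Y ε) ≠ ∞) (hτ : τ ≠ 0) {a b : ℝ} (hab : a ≤ b)
    (hb : b < a + 2 * π) :
    spectralMeasure Ω Y ε τ (sector a b) = ∫⁻ p in Ioi (0 : ℝ) ×ˢ Icc a b,
      ENNReal.ofReal (powerSpectrum Ω Y ε τ p.1 p.2 * p.1) := by
  have hm := (measurable_powerSpectrum_mul hA hA' hτ).ennreal_ofReal
  rw [spectralMeasure, withDensity_apply _ (measurableSet_sector a b), setLIntegral_sector hab hb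
      (continuous_norm_sq_waveTransform hA hA' hτ).measurable.ennreal_ofReal,
    Measure.volume_eq_prod, setLIntegral_prod_symm _ hm.aemeasurable]
  refine lintegral_congr fun ω => setLIntegral_congr_fun measurableSet_Ioi fun r hr => ?_
  beta_reduce
  rw [powerSpectrum_eq, mul_comm _ r, ENNReal.ofReal_mul (le_of_lt hr)]

theorem integrableOn_powerSpectrum (hA : MeasurableSet (trimmedDomain Ω Y ε))
    (hA' : volume (trimmedDomain Ω Y ε) ≠ ∞) (hτ : τ ≠ 0) {a b : ℝ} (hab : a ≤ b)
    (hb : b < a + 2 * π) :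
    IntegrableOn (fun p : ℝ × ℝ => powerSpectrum Ω Y ε τ p.1 p.2 * p.1)
      (Ioi 0 ×ˢ Icc a b) := by
  have := isFiniteMeasure_spectralMeasure hA hA' hτ
  refine ⟨(measurable_powerSpectrum_mul hA hA' hτ).aestronglyMeasurable, ?_⟩
  rw [hasFiniteIntegral_iff_ofReal, ← spectralMeasure_sector hA hA' hτ hab hb]
  · exact measure_lt_top _ _
  · refine (ae_restrict_iff' (measurableSet_Ioi.prod measurableSet_Icc)).2
      (Eventually.of_forall fun p hp => ?_)
    exact mul_nonneg (sq_nonneg _) (le_of_lt hp.1)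

theorem integral_powerSpectrum (hA : MeasurableSet (trimmedDomain Ω Y ε))
    (hA' : volume (trimmedDomain Ω Y ε) ≠ ∞) (hτ : τ ≠ 0) {a b : ℝ} (hab : a ≤ b)
    (hb : b < a + 2 * π) :
    ∫ ω in a..b, ∫ r in Ioi (0 : ℝ), powerSpectrum Ω Y ε τ r ω * r =
      (spectralMeasure Ω Y ε τ (sector a b)).toReal := by
  have hi := integrableOn_powerSpectrum hA hA' hτ hab hb
  have hprod : (volume : Measure (ℝ × ℝ)).restrict (Ioi 0 ×ˢ Icc a b) =
      ((volume : Measure ℝ).restrict (Ioi 0)).prod (volume.restrict (Icc a b)) := by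
    rw [Measure.prod_restrict, Measure.volume_eq_prod]
  rw [spectralMeasure_sector hA hA' hτ hab hb, ← integral_eq_lintegral_of_nonneg_ae,
    intervalIntegral.integral_of_le hab, ← integral_Icc_eq_integral_Ioc, hprod,
    integral_prod_symm]
  · rwa [← hprod]
  · refine (ae_restrict_iff' (measurableSet_Ioi.prod measurableSet_Icc)).2
      (Eventually.of_forall fun p hp => ?_)
    exact mul_nonneg (sq_nonneg _) (le_of_lt hp.1)
  · exact hi.1

end Spectrum

end DistanceTransform

/-! ### Assembly of the theorem -/

open DistanceTransform in
theorem mainTheorem3 (K : ℕ) (hK : 0 < K) (Ω : Set Plane) (hΩ : IsPolygonalDomain Ω)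
    (Y : Fin K → Plane) (hY : Function.Injective Y) (hYΩ : ∀ k, Y k ∈ Ω)
    (hstar : ∀ k, StarConvex ℝ (Y k) (voronoiCell Ω Y k))
    (ε : ℝ) (hε : 0 < ε) (hε' : ε < 1 / 2)
    (ω₀ : ℝ) (hω₀ : ω₀ ∈ Ico 0 (2 * π)) (Δ : ℝ) (hΔ : 0 < Δ) (hΔ' : Δ < 2 * π) :
    -- `P` is the density of the orientation of the gradient of the distance transform
    (IntervalIntegrable (orientationDensity Ω Y) volume ω₀ (ω₀ + Δ) ∧
      orientationDistribution Ω Y ω₀ Δ = ∫ ω in ω₀..(ω₀ + Δ), orientationDensity Ω Y ω) ∧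
    -- the power spectrum is integrable over the sector
    (∀ τ : ℝ, τ ≠ 0 →
      IntegrableOn (fun p : ℝ × ℝ => powerSpectrum Ω Y ε τ p.1 p.2 * p.1)
        (Ioi 0 ×ˢ Icc ω₀ (ω₀ + Δ))) ∧
    -- its integral converges to that of `P`
    Tendsto
      (fun τ : ℝ => ∫ ω in ω₀..(ω₀ + Δ), ∫ r in Ioi (0 : ℝ), powerSpectrum Ω Y ε τ r ω * r)
      (𝓝[≠] 0) (𝓝 (∫ ω in ω₀..(ω₀ + Δ), orientationDensity Ω Y ω)) := by
  obtain ⟨hΩc, hΩi, -⟩ := hΩ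
  have hab : ω₀ ≤ ω₀ + Δ := by linarith
  have hb : ω₀ + Δ < ω₀ + 2 * π := by linarith
  have hΩ0 : volume Ω ≠ 0 := (Measure.measure_pos_of_nonempty_interior volume hΩi).ne'
  have hA := measurableSet_trimmedDomain hΩc hYΩ hstar hε.le
  have hA' : volume (trimmedDomain Ω Y ε) ≠ ⊤ :=
    ((measure_mono (trimmedDomain_subset hΩc hYΩ hstar hε.le)).trans_lt hΩc.measure_lt_top).ne
  have hA0 : volume (trimmedDomain Ω Y ε) ≠ 0 := by
    rw [volume_trimmedDomain hK hΩc hY hYΩ hstar hε.le hε'.le]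
    refine mul_ne_zero ?_ hΩ0
    rw [ne_eq, ENNReal.ofReal_eq_zero]
    linarith
  have hint : ∫ ω in ω₀..(ω₀ + Δ), orientationDensity Ω Y ω = (1 / area Ω) *
      (∫⁻ ω in Icc ω₀ (ω₀ + Δ), ENNReal.ofReal (∑ k, rayLength Ω Y k ω ^ 2 / 2)).toReal := by
    rw [intervalIntegral.integral_of_le hab, ← integral_Icc_eq_integral_Ioc,
      ← integral_sum_rayLength hΩc hYΩ hstar, ← integral_const_mul]
    rfl
  refine ⟨⟨?_, ?_⟩, fun τ hτ => integrableOn_powerSpectrum hA hA' hτ hab hb, ?_⟩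
  · rw [intervalIntegrable_iff_integrableOn_Icc_of_le hab]
    exact (integrableOn_sum_rayLength hK hΩc hY hYΩ hstar hab hb).const_mul _
  · rw [hint, orientationDistribution, area, area,
      volume_gradient_orientation hK hΩc hY hYΩ hstar hab hb]
  · have hlim := tendsto_spectralMeasure hK hY hA hA' hA0
      (gradientLaw_frontier_sector hK hΩc hY hYΩ hstar hε hε' hab hb)
    have hprob := isProbabilityMeasure_gradientLaw hA' hA0
    have hlim' := (ENNReal.tendsto_toReal (measure_ne_top _ _)).comp hlim
    have hval : (gradientLaw Ω Y ε (sector ω₀ (ω₀ + Δ))).toReal =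
        ∫ ω in ω₀..(ω₀ + Δ), orientationDensity Ω Y ω := by
      rw [hint, gradientLaw_sector hK hΩc hY hYΩ hstar hε hε' hab hb, ENNReal.toReal_mul,
        ENNReal.toReal_inv, one_div]
      rfl
    rw [hval] at hlim'
    refine hlim'.congr' ?_
    filter_upwards [self_mem_nhdsWithin] with τ hτ
    exact (integral_powerSpectrum hA hA' hτ hab hb).symm
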